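/- Let $D$ be an integral domain with quotient field $K$, and let $F(D)$ be the set of nonzero fractional ideals of $D$. A star-operation on $D$ is a map $\ast:F(D)\to F(D)$, $A\mapsto A_\ast$, such that for all $A,B\in F(D)$ and $0\neq x\in K$: $(x)_\ast=(x)$ and $(xA)_\ast=xA_\ast$; $A\subseteq A_\ast$, and $A\subseteq B$ implies $A_\ast\subseteq B_\ast$; $(A_\ast)_\ast=A_\ast$. It is of finite character if for each $A\in F(D)$, $A_\ast=\bigcup B_\ast$ over the nonzero finitely generated fractional ideals $B\subseteq A$. For $A \in F(D)$, $A$ is $\ast$-invertible if $(AA^{-1})_\ast=D$, where $A^{-1}=\{x\in K: xA\subseteq D\}$. The $\ast$-product of finitely many ($k\ge 1$) ideals $A_1,\dots,A_k$ is $(A_1\cdots A_k)_\ast$. A maximal $\ast$-ideal is a maximal element of the set of nonzero proper ideals $P$ of $D$ with $P_\ast=P$; such ideals are prime, and $\ast\text{-}\mathrm{Max}(D)$ denotes the set of them. A nonzero finitely generated ideal $A$ of $D$ is $\ast$-homogeneous if it is contained in a unique maximal $\ast$-ideal, denoted $M(A)$; it is of type 2 if moreover $A_\ast=(M(A)^n)_\ast$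 for some $n\ge 1$. A $\ast$-homogeneous ideal $A$ is $\ast$-almost super-homogeneous if it is $\ast$-invertible and, whenever $b_1,\dots,b_s\in M(A)$ and $A^r\subseteq(b_1,\dots,b_s)_\ast$ for some $r\ge1$, there is an $n\ge1$ such that $(b_1^n,\dots,b_s^n)$ is $\ast$-invertible. $D$ is a $\ast$-SH domain of type 2 (respectively, a $\ast$-almost super-SH domain of type 2) if every nonzero proper principal ideal of $D$ is a $\ast$-product of $\ast$-homogeneous ideals of type 2 (respectively, of $\ast$-almost super-homogeneous ideals of type 2). $D$ is a $\ast$-Krull domain if (a) $D=\bigcap\{D_P: P\in\ast\text{-}\mathrm{Max}(D)\}$; (b) every nonzero nonunit of $D$ lies in only finitely many maximal $\ast$-ideals; (c) no two distinct maximal $\ast$-ideals contain a common nonzero prime ideal; (d) $\ast\text{-}\mathrm{Max}(D)$ is the set of height-one primes of $D$; and (e) $D_P$ is a DVR for every $P\in\ast\text{-}\mathrm{Max}(D)$. Corollary 3.3. Let $D$ be a domain and $\ast$ a finite character star-operation on $D$. The following statements are equivalent. 1. $D$ is a $\ast$-almost super-SH domain of type 2. 2. $D$ is a $\ast$-Krull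 domain. 3. If $A$ is a finitely generated $\ast$-invertible ideal of $D$ with $A_\ast\neq D$, then $A_\ast$ is a $\ast$-product of $\ast$-almost super-homogeneous ideals of type 2. 4. $D$ is a $\ast$-SH domain of type 2. -/

import Mathlib

open scoped nonZeroDivisors

/-- A star-operation on a domain `D` with quotient field `K`: a closure operation `A ↦ A_*` on the
nonzero fractional ideals of `D`. The map is made total by the convention `0_* = 0`; all the
other axioms concern nonzero fractional ideals only (and `A ≤ A_*` keeps `A_*` nonzero). -/
structure StarOperation (D K : Type*) [CommRing D] [IsDomain D] [Field K] [Algebra D K]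
    [IsFractionRing D K] where
  /-- The map `A ↦ A_*`. -/
  toFun : FractionalIdeal D⁰ K → FractionalIdeal D⁰ K
  toFun_zero : toFun 0 = 0
  principal : ∀ x : K, x ≠ 0 →
    toFun (FractionalIdeal.spanSingleton D⁰ x) = FractionalIdeal.spanSingleton D⁰ x
  smul : ∀ (x : K) (A : FractionalIdeal D⁰ K), x ≠ 0 → A ≠ 0 →
    toFun (FractionalIdeal.spanSingleton D⁰ x * A) =
      FractionalIdeal.spanSingleton D⁰ x * toFun A
  le_star : ∀ A : FractionalIdeal D⁰ K, A ≠ 0 → A ≤ toFun A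
  mono : ∀ A B : FractionalIdeal D⁰ K, A ≠ 0 → B ≠ 0 → A ≤ B → toFun A ≤ toFun B
  idem : ∀ A : FractionalIdeal D⁰ K, A ≠ 0 → toFun (toFun A) = toFun A

namespace StarOperation

variable {D K : Type*} [CommRing D] [IsDomain D] [Field K] [Algebra D K] [IsFractionRing D K]

/-- `S.ideal A` is the fractional ideal `A_*`, for an integral ideal `A` of `D`. -/
def ideal (S : StarOperation D K) (A : Ideal D) : FractionalIdeal D⁰ K :=
  S.toFun (A : FractionalIdeal D⁰ K)

/-- `S` is of finite character: `A_*` is the union of the `B_*`, where `B` runs over the nonzero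
finitely generated fractional ideals contained in `A`. -/
def IsFiniteCharacter (S : StarOperation D K) : Prop :=
  ∀ A : FractionalIdeal D⁰ K, A ≠ 0 → ∀ x : K, x ∈ S.toFun A ↔
    ∃ B : FractionalIdeal D⁰ K, B ≠ 0 ∧ (B : Submodule D K).FG ∧ B ≤ A ∧ x ∈ S.toFun B

/-- A nonzero fractional ideal `A` is `*`-invertible: `(A A⁻¹)_* = D`, where
`A⁻¹ = {x ∈ K | x A ⊆ D}`. -/
def IsStarInvertible (S : StarOperation D K) (A : FractionalIdeal D⁰ K) : Prop :=
  A ≠ 0 ∧ S.toFun (A * A⁻¹) = 1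

/-- A (nonzero, integral) `*`-ideal of `D`. -/
def IsStarIdeal (S : StarOperation D K) (A : Ideal D) : Prop :=
  A ≠ ⊥ ∧ S.ideal A = (A : FractionalIdeal D⁰ K)

/-- A maximal `*`-ideal: maximal among the proper (nonzero, integral) `*`-ideals of `D`. -/
def IsMaximalStarIdeal (S : StarOperation D K) (P : Ideal D) : Prop :=
  Maximal (fun A : Ideal D => S.IsStarIdeal A ∧ A ≠ ⊤) P

/-- Every maximal `*`-ideal is prime. -/
theorem IsMaximalStarIdeal.isPrime {S : StarOperation D K} {P : Ideal D}
    (hP : S.IsMaximalStarIdeal P) : P.IsPrime := by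
  obtain ⟨⟨⟨hP0, hPs⟩, hPtop⟩, hmax⟩ := hP
  refine ⟨hPtop, ?_⟩
  intro a b hab
  by_contra! hcon
  obtain ⟨ha, hb⟩ := hcon
  have hb0 : b ≠ 0 := fun h => hb (h ▸ P.zero_mem)
  have hbK : algebraMap D K b ≠ 0 := by
    simpa using hb0
  set I : Ideal D := P ⊔ Ideal.span {a} with hI
  have hPI : P ≤ I := le_sup_left
  have haI : a ∈ I := Ideal.mem_sup_right (Ideal.mem_span_singleton_self a)
  have hI0 : I ≠ ⊥ := fun h => hP0 (le_bot_iff.mp (h ▸ hPI))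
  have hI0' : (I : FractionalIdeal D⁰ K) ≠ 0 := by simpa using hI0
  have hP0' : (P : FractionalIdeal D⁰ K) ≠ 0 := by simpa using hP0
  have hone : S.toFun (1 : FractionalIdeal D⁰ K) = 1 := by
    simpa using S.principal 1 one_ne_zero
  have hle : S.toFun (I : FractionalIdeal D⁰ K) ≤ 1 := by
    rw [← hone]
    exact S.mono _ _ hI0' one_ne_zero FractionalIdeal.coeIdeal_le_one
  obtain ⟨J, hJ⟩ := FractionalIdeal.le_one_iff_exists_coeIdeal.mp hle
  have hIJ : I ≤ J := by
    have := S.le_star _ hI0'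
    rw [← hJ] at this
    exact (FractionalIdeal.coeIdeal_le_coeIdeal K).mp this
  have hJs : S.IsStarIdeal J := by
    refine ⟨fun h => hI0 (le_bot_iff.mp (h ▸ hIJ)), ?_⟩
    unfold StarOperation.ideal
    rw [hJ, S.idem _ hI0']
  have hJtop : J = ⊤ := by
    by_contra hne
    exact ha (hmax ⟨hJs, hne⟩ (hPI.trans hIJ) (hIJ haI))
  have hI1 : S.toFun (I : FractionalIdeal D⁰ K) = 1 := by
    rw [← hJ, hJtop]; simp
  have hbI : FractionalIdeal.spanSingleton D⁰ (algebraMap D K b) * (I : FractionalIdeal D⁰ K)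
      ≤ (P : FractionalIdeal D⁰ K) := by
    rw [← FractionalIdeal.coeIdeal_span_singleton, ← FractionalIdeal.coeIdeal_mul,
      FractionalIdeal.coeIdeal_le_coeIdeal, hI, Ideal.mul_sup]
    refine sup_le Ideal.mul_le_right ?_
    rw [Ideal.span_singleton_mul_span_singleton, Ideal.span_singleton_le_iff_mem, mul_comm]
    exact hab
  have hbI0 : FractionalIdeal.spanSingleton D⁰ (algebraMap D K b) *
      (I : FractionalIdeal D⁰ K) ≠ 0 := by
    rw [← FractionalIdeal.coeIdeal_span_singleton, ← FractionalIdeal.coeIdeal_mul]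
    rw [FractionalIdeal.coeIdeal_ne_zero, ← Ideal.zero_eq_bot]
    exact mul_ne_zero (by simpa using hb0) hI0
  have h1 := S.mono _ _ hbI0 hP0' hbI
  rw [S.smul _ _ hbK hI0', hI1, mul_one] at h1
  change _ ≤ S.ideal P at h1
  rw [hPs, ← FractionalIdeal.coeIdeal_span_singleton,
    FractionalIdeal.coeIdeal_le_coeIdeal, Ideal.span_singleton_le_iff_mem] at h1
  exact hb h1

/-- `*-Max(D)`, the set of maximal `*`-ideals, as a set of prime ideals. Nothing is lost, since
every maximal `*`-ideal is prime. -/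
def starMax (S : StarOperation D K) : Set (PrimeSpectrum D) :=
  {P | S.IsMaximalStarIdeal P.asIdeal}

end StarOperation

section Families

variable (D : Type*) [CommRing D] [IsDomain D]

/-- `F` is a defining family: `D = ⋂_{P ∈ F} D_P` inside the quotient field `K`. -/
def IsDefiningFamily (K : Type*) [Field K] [Algebra D K] [IsFractionRing D K]
    (F : Set (PrimeSpectrum D)) : Prop :=
  (⨅ P ∈ F, Localization.subalgebra.ofField K P.asIdeal.primeCompl
    P.asIdeal.primeCompl_le_nonZeroDivisors) = (⊥ : Subalgebra D K)

/-- `F` is of finite character: each nonzero nonunit lies in only finitely many members. -/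
def IsLocallyFiniteFamily (F : Set (PrimeSpectrum D)) : Prop :=
  ∀ x : D, x ≠ 0 → ¬ IsUnit x → {P | P ∈ F ∧ x ∈ P.asIdeal}.Finite

/-- `F` is independent: no two distinct members contain a common nonzero prime ideal. -/
def IsIndependentFamily (F : Set (PrimeSpectrum D)) : Prop :=
  ∀ P ∈ F, ∀ Q ∈ F, P ≠ Q →
    ¬ ∃ N : Ideal D, N.IsPrime ∧ N ≠ ⊥ ∧ N ≤ P.asIdeal ∧ N ≤ Q.asIdeal

/-- `X⁽¹⁾(D)`, the set of height-one prime ideals. -/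
def heightOnePrimes : Set (PrimeSpectrum D) :=
  {P | P.asIdeal.height = 1}

end Families

namespace StarOperation

variable {D K : Type*} [CommRing D] [IsDomain D] [Field K] [Algebra D K] [IsFractionRing D K]

/-- `D` is `*`-h-local: `*-Max(D)` is an independent defining family of finite character. -/
def IsHLocal (S : StarOperation D K) : Prop :=
  IsDefiningFamily D K S.starMax ∧ IsLocallyFiniteFamily D S.starMax ∧
    IsIndependentFamily D S.starMax

/-- `D` is a `*`-weakly Krull domain. -/
def IsWeaklyKrull (S : StarOperation D K) : Prop :=
  S.IsHLocal ∧ S.starMax = heightOnePrimes D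

/-- `D` is a `*`-Krull domain. -/
def IsKrull (S : StarOperation D K) : Prop :=
  S.IsWeaklyKrull ∧
    ∀ P ∈ S.starMax, IsDiscreteValuationRing (Localization.AtPrime P.asIdeal)

/-- `A` is `P`-`*`-homogeneous: `A` is nonzero and finitely generated, and `P` is the unique
maximal `*`-ideal containing `A`. Thus `P = M(A)`. -/
def IsHomogeneousAt (S : StarOperation D K) (P A : Ideal D) : Prop :=
  A ≠ ⊥ ∧ A.FG ∧ (S.IsMaximalStarIdeal P ∧ A ≤ P) ∧
    ∀ Q : Ideal D, S.IsMaximalStarIdeal Q → A ≤ Q → Q = P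

/-- `A` is a `*`-homogeneous ideal of type 2: `A_* = (M(A)ⁿ)_*` for some `n ≥ 1`. -/
def IsHomogeneousTypeTwo (S : StarOperation D K) (A : Ideal D) : Prop :=
  ∃ P : Ideal D, S.IsHomogeneousAt P A ∧ ∃ n : ℕ, 1 ≤ n ∧ S.ideal A = S.ideal (P ^ n)

/-- `A` is a `*`-almost super-homogeneous ideal. -/
def IsAlmostSuperHomogeneous (S : StarOperation D K) (A : Ideal D) : Prop :=
  ∃ P : Ideal D, S.IsHomogeneousAt P A ∧ S.IsStarInvertible (A : FractionalIdeal D⁰ K) ∧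
    ∀ (s : ℕ) (b : Fin s → D), (∀ i, b i ∈ P) →
      (∃ r : ℕ, 1 ≤ r ∧
        ((A ^ r : Ideal D) : FractionalIdeal D⁰ K) ≤ S.ideal (Ideal.span (Set.range b))) →
      ∃ n : ℕ, 1 ≤ n ∧ S.IsStarInvertible
        ((Ideal.span (Set.range fun i => b i ^ n) : Ideal D) : FractionalIdeal D⁰ K)

/-- `A` is a `*`-almost super-homogeneous ideal of type 2. -/
def IsAlmostSuperHomogeneousTypeTwo (S : StarOperation D K) (A : Ideal D) : Prop :=
  S.IsAlmostSuperHomogeneous A ∧ S.IsHomogeneousTypeTwo A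

/-- `I` is a (finite, nonempty) `*`-product `(A₁ ⋯ A_k)_*` of integral ideals `Aᵢ` satisfying
`p`. -/
def IsStarProductOf (S : StarOperation D K) (p : Ideal D → Prop)
    (I : FractionalIdeal D⁰ K) : Prop :=
  ∃ l : List (Ideal D), l ≠ [] ∧ (∀ A ∈ l, p A) ∧ I = S.ideal l.prod

/-- `D` is a `*`-SH domain of type 2: each nonzero proper principal ideal is a `*`-product of
`*`-homogeneous ideals of type 2. -/
def IsSHTypeTwo (S : StarOperation D K) : Prop :=
  ∀ x : D, x ≠ 0 → ¬ IsUnit x →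
    S.IsStarProductOf S.IsHomogeneousTypeTwo ((Ideal.span {x} : Ideal D) : FractionalIdeal D⁰ K)

/-- `D` is a `*`-almost super-SH domain of type 2: each nonzero proper principal ideal is a
`*`-product of `*`-almost super-homogeneous ideals of type 2. -/
def IsAlmostSuperSHTypeTwo (S : StarOperation D K) : Prop :=
  ∀ x : D, x ≠ 0 → ¬ IsUnit x →
    S.IsStarProductOf S.IsAlmostSuperHomogeneousTypeTwo
      ((Ideal.span {x} : Ideal D) : FractionalIdeal D⁰ K)

end StarOperation

open scoped nonZeroDivisors

namespace StarOperation

variable {D K : Type*} [CommRing D] [IsDomain D] [Field K] [Algebra D K] [IsFractionRing D K]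
  (S : StarOperation D K)

/-! The pivot is unique-factorization-like: nonzero principal ideals are, up to closure, products of
maximal `*`-ideals. (4) gives this at once, since type 2 replaces each factor by a power `Pⁿ`. Every
maximal `*`-ideal `P` then divides a principal ideal, so it is `*`-invertible and `P D_P = (π)`. As
`xD` contains a product of maximal `*`-ideals, `x` divides a power of `π` in `D_P`. So `D_P` is a
DVR, and the remaining Krull conditions are read off the factorizations (`IsSHTypeTwo.isKrull`).
Conversely, finite character makes closures determined by localizations at maximal `*`-ideals
(`ideal_eq_ideal_of_map_eq`). In a `*`-Krull domain this gives `A_* = (∏ P ^ n_P)_*` for every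
nonzero `A`. Hence every such `A` is `*`-invertible, and each `P` is the closure of a finitely
generated ideal that is almost super-homogeneous of type 2, which yields (3). (3) contains (1) as
the principal case, and (1) weakens to (4). -/

/-! ### Calculus of the closure, with `0_* = 0` removing nonvanishing hypotheses. -/

theorem toFun_one : S.toFun 1 = 1 := by
  simpa using S.principal 1 one_ne_zero

theorem le_toFun (A : FractionalIdeal D⁰ K) : A ≤ S.toFun A := by
  rcases eq_or_ne A 0 with rfl | hA
  · rw [S.toFun_zero]
  · exact S.le_star A hA

theorem toFun_toFun (A : FractionalIdeal D⁰ K) : S.toFun (S.toFun A) = S.toFun A := by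
  rcases eq_or_ne A 0 with rfl | hA
  · rw [S.toFun_zero, S.toFun_zero]
  · exact S.idem A hA

theorem toFun_mono {A B : FractionalIdeal D⁰ K} (h : A ≤ B) : S.toFun A ≤ S.toFun B := by
  rcases eq_or_ne A 0 with rfl | hA
  · rw [S.toFun_zero]; exact bot_le
  · refine S.mono A B hA ?_ h
    rintro rfl
    exact hA (le_bot_iff.mp h)

theorem toFun_le_iff {A B : FractionalIdeal D⁰ K} : S.toFun A ≤ S.toFun B ↔ A ≤ S.toFun B :=
  ⟨(S.le_toFun A).trans, fun h => S.toFun_toFun B ▸ S.toFun_mono h⟩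

theorem spanSingleton_mul_toFun (x : K) (A : FractionalIdeal D⁰ K) :
    S.toFun (FractionalIdeal.spanSingleton D⁰ x * A) =
      FractionalIdeal.spanSingleton D⁰ x * S.toFun A := by
  rcases eq_or_ne x 0 with rfl | hx
  · simp [S.toFun_zero]
  rcases eq_or_ne A 0 with rfl | hA
  · simp [S.toFun_zero]
  exact S.smul x A hx hA

/-- Homogeneity gives `a B_* = (aB)_* ⊆ (AB)_*` for each `a ∈ A`, and such products generate `A
B_*`. -/
theorem toFun_mul_toFun (A B : FractionalIdeal D⁰ K) :
    S.toFun (A * S.toFun B) = S.toFun (A * B) := by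
  refine le_antisymm (S.toFun_le_iff.mpr ?_) (S.toFun_mono (mul_le_mul_right (S.le_toFun B) A))
  rw [FractionalIdeal.mul_le]
  intro a ha b hb
  have h : FractionalIdeal.spanSingleton D⁰ a * S.toFun B ≤ S.toFun (A * B) := by
    rw [← S.spanSingleton_mul_toFun]
    exact S.toFun_mono (mul_le_mul_left (FractionalIdeal.spanSingleton_le_iff_mem.mpr ha) B)
  exact h (FractionalIdeal.mul_mem_mul (FractionalIdeal.mem_spanSingleton_self D⁰ a) hb)

theorem toFun_mul_congr {A A' B B' : FractionalIdeal D⁰ K} (hA : S.toFun A = S.toFun A')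
    (hB : S.toFun B = S.toFun B') : S.toFun (A * B) = S.toFun (A' * B') := by
  rw [← S.toFun_mul_toFun, hB, S.toFun_mul_toFun, mul_comm, ← S.toFun_mul_toFun, hA,
    S.toFun_mul_toFun, mul_comm]

theorem ideal_le_one (A : Ideal D) : S.ideal A ≤ 1 := by
  rw [← S.toFun_one]
  exact S.toFun_mono FractionalIdeal.coeIdeal_le_one

theorem coe_le_ideal (A : Ideal D) : (A : FractionalIdeal D⁰ K) ≤ S.ideal A :=
  S.le_toFun _

theorem ideal_mono {A B : Ideal D} (h : A ≤ B) : S.ideal A ≤ S.ideal B :=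
  S.toFun_mono ((FractionalIdeal.coeIdeal_le_coeIdeal K).mpr h)

theorem ideal_top : S.ideal ⊤ = 1 := by
  rw [ideal, FractionalIdeal.coeIdeal_top, S.toFun_one]

theorem ideal_mul_congr {A A' B B' : Ideal D} (hA : S.ideal A = S.ideal A')
    (hB : S.ideal B = S.ideal B') : S.ideal (A * B) = S.ideal (A' * B') := by
  rw [ideal, ideal, FractionalIdeal.coeIdeal_mul, FractionalIdeal.coeIdeal_mul]
  exact S.toFun_mul_congr hA hB

theorem ideal_span_singleton (x : D) :
    S.ideal (Ideal.span {x}) = ((Ideal.span {x} : Ideal D) : FractionalIdeal D⁰ K) := by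
  rw [ideal, FractionalIdeal.coeIdeal_span_singleton]
  simpa [S.toFun_one] using S.spanSingleton_mul_toFun (algebraMap D K x) 1

theorem exists_coeIdeal_eq_ideal (A : Ideal D) :
    ∃ J : Ideal D, (J : FractionalIdeal D⁰ K) = S.ideal A ∧ A ≤ J := by
  obtain ⟨J, hJ⟩ := FractionalIdeal.le_one_iff_exists_coeIdeal.mp (S.ideal_le_one A)
  exact ⟨J, hJ, (FractionalIdeal.coeIdeal_le_coeIdeal K).mp (hJ ▸ S.coe_le_ideal A)⟩

/-! ### `*`-invertibility. -/

variable {S}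

/-- Any `*`-inverse `B` lies in `A⁻¹`, because `AB ⊆ (AB)_* = D`. Invertibility can thus be shown
with any convenient witness. -/
theorem isStarInvertible_of_mul {A B : FractionalIdeal D⁰ K} (h : S.toFun (A * B) = 1) :
    S.IsStarInvertible A := by
  have hA : A ≠ 0 := by
    rintro rfl
    rw [zero_mul, S.toFun_zero] at h
    exact zero_ne_one h
  have hle : A * A⁻¹ ≤ 1 := by
    rw [FractionalIdeal.mul_le]
    intro a ha b hb
    rw [mul_comm]
    exact (FractionalIdeal.mem_inv_iff hA).mp hb a ha
  refine ⟨hA, le_antisymm (S.toFun_one ▸ S.toFun_mono hle) ?_⟩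
  rw [← h]
  refine S.toFun_mono (mul_le_mul_right ?_ A)
  intro b hb
  rw [FractionalIdeal.mem_inv_iff hA]
  intro a ha
  have := S.le_toFun (A * B) (FractionalIdeal.mul_mem_mul ha hb)
  rwa [h, mul_comm] at this

theorem IsStarInvertible.of_toFun_eq {A B : FractionalIdeal D⁰ K} (hA : S.IsStarInvertible A)
    (h : S.toFun A = S.toFun B) : S.IsStarInvertible B := by
  refine isStarInvertible_of_mul (B := A⁻¹) ?_
  rw [← hA.2]
  exact S.toFun_mul_congr h.symm rfl

theorem IsStarInvertible.mul {A B : FractionalIdeal D⁰ K} (hA : S.IsStarInvertible A)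
    (hB : S.IsStarInvertible B) : S.IsStarInvertible (A * B) := by
  refine isStarInvertible_of_mul (B := A⁻¹ * B⁻¹) ?_
  rw [mul_mul_mul_comm, ← S.toFun_mul_toFun, hB.2, mul_one, hA.2]

theorem isStarInvertible_one : S.IsStarInvertible 1 :=
  isStarInvertible_of_mul (B := 1) (by rw [mul_one, S.toFun_one])

theorem isStarInvertible_spanSingleton {x : K} (hx : x ≠ 0) :
    S.IsStarInvertible (FractionalIdeal.spanSingleton D⁰ x) := by
  refine isStarInvertible_of_mul (B := FractionalIdeal.spanSingleton D⁰ x⁻¹) ?_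
  rw [FractionalIdeal.spanSingleton_mul_spanSingleton, mul_inv_cancel₀ hx,
    FractionalIdeal.spanSingleton_one, S.toFun_one]

theorem IsStarInvertible.of_mul_left {A B : FractionalIdeal D⁰ K}
    (h : S.IsStarInvertible (A * B)) : S.IsStarInvertible A :=
  isStarInvertible_of_mul (B := B * (A * B)⁻¹) (by rw [← mul_assoc, h.2])

/-! ### Maximal `*`-ideals and their existence. -/

theorem IsMaximalStarIdeal.ideal_eq {P : Ideal D} (hP : S.IsMaximalStarIdeal P) :
    S.ideal P = (P : FractionalIdeal D⁰ K) := hP.1.1.2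

theorem IsMaximalStarIdeal.ne_bot {P : Ideal D} (hP : S.IsMaximalStarIdeal P) : P ≠ ⊥ :=
  hP.1.1.1

theorem IsMaximalStarIdeal.eq_of_le {P Q : Ideal D} (hP : S.IsMaximalStarIdeal P)
    (hQ : S.IsMaximalStarIdeal Q) (h : P ≤ Q) : P = Q :=
  le_antisymm h (hP.2 hQ.1 h)

theorem IsMaximalStarIdeal.le_of_ideal_le {P A : Ideal D} (hP : S.IsMaximalStarIdeal P)
    (h : S.ideal A ≤ S.ideal P) : A ≤ P := by
  rw [hP.ideal_eq] at h
  exact (FractionalIdeal.coeIdeal_le_coeIdeal K).mp ((S.coe_le_ideal A).trans h)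

/-- Zorn's lemma applies because the union of a chain of `*`-ideals is a `*`-ideal: by finite
character an element of its closure lies in the closure of a finitely generated subideal, which sits
inside one member of the chain. -/
theorem IsFiniteCharacter.exists_isMaximalStarIdeal (hS : S.IsFiniteCharacter) {A : Ideal D}
    (hA : A ≠ ⊥) (h : S.ideal A ≠ 1) : ∃ P, S.IsMaximalStarIdeal P ∧ A ≤ P := by
  obtain ⟨J, hJ, hAJ⟩ := S.exists_coeIdeal_eq_ideal A
  have hJbot : J ≠ ⊥ := fun h => hA (le_bot_iff.mp (h ▸ hAJ))
  have hJs : S.IsStarIdeal J := ⟨hJbot, by rw [ideal, hJ, ideal, S.toFun_toFun]⟩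
  have hJtop : J ≠ ⊤ := by
    rintro rfl
    exact h (by rw [← hJ, FractionalIdeal.coeIdeal_top])
  have ih : ∀ c ⊆ {B : Ideal D | S.IsStarIdeal B ∧ B ≠ ⊤}, IsChain (· ≤ ·) c → ∀ y ∈ c,
      ∃ ub ∈ {B : Ideal D | S.IsStarIdeal B ∧ B ≠ ⊤}, ∀ z ∈ c, z ≤ ub := by
    intro c hc hchain y hy
    have hle : y ≤ sSup c := le_sSup hy
    have hbot : sSup c ≠ ⊥ := fun h => (hc hy).1.1 (le_bot_iff.mp (h ▸ hle))
    refine ⟨sSup c, ⟨⟨hbot, le_antisymm ?_ (S.coe_le_ideal _)⟩, ?_⟩, fun z hz => le_sSup hz⟩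
    · intro x hx
      obtain ⟨B, hB0, hBfg, hB, hxB⟩ := (hS _ (by simpa using hbot) x).mp hx
      obtain ⟨B', rfl⟩ := FractionalIdeal.le_one_iff_exists_coeIdeal.mp
        (hB.trans FractionalIdeal.coeIdeal_le_one)
      rw [FractionalIdeal.coeIdeal_fg _ (IsFractionRing.injective D K)] at hBfg
      rw [FractionalIdeal.coeIdeal_le_coeIdeal] at hB
      obtain ⟨z, hz, hBz⟩ := (CompleteLattice.isCompactElement_iff_le_of_directed_sSup_le _ _).mp
        ((Submodule.fg_iff_compact _).mp hBfg) c ⟨y, hy⟩ hchain.directedOn hB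
      have h1 := S.ideal_mono hBz hxB
      rw [(hc hz).1.2] at h1
      exact (FractionalIdeal.coeIdeal_le_coeIdeal K).mpr (le_sSup hz) h1
    · intro htop
      have h1 : (1 : D) ∈ sSup c := htop ▸ Submodule.mem_top
      obtain ⟨z, hz, h1z⟩ := (Submodule.mem_sSup_of_directed ⟨y, hy⟩ hchain.directedOn).mp h1
      exact (hc hz).2 ((Ideal.eq_top_iff_one z).mpr h1z)
  obtain ⟨P, hJP, hP⟩ := zorn_le_nonempty₀ _ ih J ⟨hJs, hJtop⟩
  exact ⟨P, hP, hAJ.trans hJP⟩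

theorem IsFiniteCharacter.ideal_eq_one (hS : S.IsFiniteCharacter) {A : Ideal D}
    (hA : A ≠ ⊥) (h : ∀ P, S.IsMaximalStarIdeal P → ¬ A ≤ P) : S.ideal A = 1 := by
  by_contra hne
  obtain ⟨P, hP, hAP⟩ := hS.exists_isMaximalStarIdeal hA hne
  exact h P hP hAP

/-! ### Closures are determined locally. -/

/-- An element of `K` which lies in `B D_P` for all maximal `*`-ideals `P` lies in `B_*`. -/
theorem IsFiniteCharacter.mem_ideal_of_local (hS : S.IsFiniteCharacter) {B : Ideal D}
    (hB : B ≠ ⊥) {x : K}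
    (h : ∀ P, S.IsMaximalStarIdeal P → ∃ s ∉ P, ∃ b ∈ B, algebraMap D K s * x = algebraMap D K b) :
    x ∈ S.ideal B := by
  obtain ⟨⟨a, t⟩, hat⟩ := IsLocalization.surj D⁰ x
  -- `C = {d | d x ∈ B}`. The hypothesis puts `C` in no maximal `*`-ideal, so `C_* = D` and `x ∈ x
  -- C_* = (xC)_* ⊆ B_*`.
  let C : Ideal D := Submodule.comap (LinearMap.toSpanSingleton D K x)
    ((B : FractionalIdeal D⁰ K) : Submodule D K)
  have hC : ∀ d, d ∈ C ↔ ∃ b ∈ B, algebraMap D K b = algebraMap D K d * x := by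
    intro d
    simp [C, Algebra.smul_def]
  have hC0 : C ≠ ⊥ := by
    obtain ⟨b, hb, hb0⟩ := Submodule.exists_mem_ne_zero_of_ne_bot hB
    refine (Submodule.ne_bot_iff C).mpr
      ⟨t * b, (hC _).mpr ⟨a * b, Ideal.mul_mem_left _ _ hb, ?_⟩,
        mul_ne_zero (nonZeroDivisors.coe_ne_zero t) hb0⟩
    rw [map_mul, map_mul, ← hat]
    ring
  have hC1 : S.ideal C = 1 := by
    refine hS.ideal_eq_one hC0 fun P hP hle => ?_
    obtain ⟨s, hs, b, hb, hsb⟩ := h P hP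
    exact hs (hle ((hC s).mpr ⟨b, hb, hsb.symm⟩))
  have hle : FractionalIdeal.spanSingleton D⁰ x * (C : FractionalIdeal D⁰ K) ≤ B := by
    rw [FractionalIdeal.spanSingleton_mul_le_iff]
    intro z hz
    obtain ⟨d, hd, rfl⟩ := (FractionalIdeal.mem_coeIdeal _).mp hz
    obtain ⟨b, hb, hbd⟩ := (hC d).mp hd
    exact (FractionalIdeal.mem_coeIdeal _).mpr ⟨b, hb, by rw [hbd, mul_comm]⟩
  have h1 := S.toFun_mono hle
  rw [S.spanSingleton_mul_toFun] at h1
  change _ * S.ideal C ≤ _ at h1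
  rw [hC1, mul_one] at h1
  exact h1 (FractionalIdeal.mem_spanSingleton_self D⁰ x)

theorem IsFiniteCharacter.ideal_le_ideal_of_map_le (hS : S.IsFiniteCharacter) {A B : Ideal D}
    (hB : B ≠ ⊥)
    (h : ∀ P : PrimeSpectrum D, P ∈ S.starMax →
      A.map (algebraMap D (Localization.AtPrime P.asIdeal)) ≤
        B.map (algebraMap D (Localization.AtPrime P.asIdeal))) :
    S.ideal A ≤ S.ideal B := by
  refine S.toFun_le_iff.mpr fun x hx => ?_
  obtain ⟨a, ha, rfl⟩ := (FractionalIdeal.mem_coeIdeal _).mp hx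
  refine hS.mem_ideal_of_local hB fun P hP => ?_
  have := hP.isPrime
  obtain ⟨s, hs, hsa⟩ := (IsLocalization.algebraMap_mem_map_algebraMap_iff P.primeCompl _ _ _).mp
    (h ⟨P, hP.isPrime⟩ hP (Ideal.mem_map_of_mem _ ha))
  exact ⟨s, hs, s * a, hsa, (map_mul _ _ _).symm⟩

theorem IsFiniteCharacter.ideal_eq_ideal_of_map_eq (hS : S.IsFiniteCharacter) {A B : Ideal D}
    (hA : A ≠ ⊥) (hB : B ≠ ⊥)
    (h : ∀ P : PrimeSpectrum D, P ∈ S.starMax →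
      A.map (algebraMap D (Localization.AtPrime P.asIdeal)) =
        B.map (algebraMap D (Localization.AtPrime P.asIdeal))) :
    S.ideal A = S.ideal B :=
  le_antisymm (hS.ideal_le_ideal_of_map_le hB fun P hP => (h P hP).le)
    (hS.ideal_le_ideal_of_map_le hA fun P hP => (h P hP).ge)

/-- This is the local description of closures applied to `D_* = D`. -/
theorem IsFiniteCharacter.isDefiningFamily_starMax (hS : S.IsFiniteCharacter) :
    IsDefiningFamily D K S.starMax := by
  refine le_bot_iff.mp fun x hx => ?_
  have h : x ∈ S.ideal ⊤ := by
    refine hS.mem_ideal_of_local top_ne_bot fun P hP => ?_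
    have hx := (Algebra.mem_iInf.mp (Algebra.mem_iInf.mp hx ⟨P, hP.isPrime⟩)) hP
    obtain ⟨a, s, hs, rfl⟩ := hx
    have hs0 : algebraMap D K s ≠ 0 := by
      rw [Ne, FaithfulSMul.algebraMap_eq_zero_iff]
      rintro rfl
      exact hs P.zero_mem
    exact ⟨s, hs, a, Submodule.mem_top, by field_simp⟩
  rw [S.ideal_top] at h
  obtain ⟨d, rfl⟩ := (FractionalIdeal.mem_one_iff D⁰).mp h
  exact Subalgebra.algebraMap_mem _ d

/-! ### Factorization in `*`-Krull domains. -/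

theorem map_localization_ne_bot (P : PrimeSpectrum D) {A : Ideal D} (hA : A ≠ ⊥) :
    A.map (algebraMap D (Localization.AtPrime P.asIdeal)) ≠ ⊥ := by
  rwa [Ne, Ideal.map_eq_bot_iff_of_injective
    (IsLocalization.injective _ P.asIdeal.primeCompl_le_nonZeroDivisors)]

theorem exists_map_eq_pow (P : PrimeSpectrum D)
    [IsDiscreteValuationRing (Localization.AtPrime P.asIdeal)] {A : Ideal D} (hA : A ≠ ⊥) :
    ∃ n : ℕ, A.map (algebraMap D (Localization.AtPrime P.asIdeal)) =
      (P.asIdeal.map (algebraMap D (Localization.AtPrime P.asIdeal))) ^ n := by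
  obtain ⟨p, hp⟩ :=
    IsDiscreteValuationRing.exists_irreducible (Localization.AtPrime P.asIdeal)
  obtain ⟨n, hn⟩ := IsDiscreteValuationRing.ideal_eq_span_pow_irreducible
    (map_localization_ne_bot P hA) hp
  refine ⟨n, ?_⟩
  rw [hn, Localization.AtPrime.map_eq_maximalIdeal, ← Ideal.span_singleton_pow]
  exact congrArg (· ^ n) hp.maximalIdeal_eq.symm

theorem map_eq_top_of_ne {P Q : PrimeSpectrum D} (hP : P ∈ S.starMax) (hQ : Q ∈ S.starMax)
    (h : P ≠ Q) : P.asIdeal.map (algebraMap D (Localization.AtPrime Q.asIdeal)) = ⊤ :=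
  IsLocalization.AtPrime.map_eq_top_of_not_le _
    fun hle => h (PrimeSpectrum.ext (IsMaximalStarIdeal.eq_of_le hP hQ hle))

theorem _root_.Ideal.list_prod_ne_bot {l : List (Ideal D)} (h : ∀ A ∈ l, A ≠ ⊥) :
    l.prod ≠ ⊥ :=
  fun h0 => h _ (List.prod_eq_zero_iff.mp h0) rfl

/-- In a `*`-Krull domain every nonzero ideal is, up to `*`, a product of maximal `*`-ideals. -/
theorem IsKrull.exists_ideal_eq_list_prod (hS : S.IsFiniteCharacter) (hK : S.IsKrull)
    {A : Ideal D} (hA : A ≠ ⊥) :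
    ∃ l : List (Ideal D), (∀ P ∈ l, S.IsMaximalStarIdeal P) ∧ S.ideal A = S.ideal l.prod := by
  obtain ⟨⟨⟨-, hfin, -⟩, -⟩, hdvr⟩ := hK
  obtain ⟨a, ha, ha0⟩ := Submodule.exists_mem_ne_zero_of_ne_bot hA
  by_cases hau : IsUnit a
  · refine ⟨[], by simp, ?_⟩
    rw [Ideal.eq_top_of_isUnit_mem A ha hau, List.prod_nil, Ideal.one_eq_top]
  have hT := hfin a ha0 hau
  have hn : ∀ P : PrimeSpectrum D, ∃ n : ℕ, P ∈ S.starMax →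
      A.map (algebraMap D (Localization.AtPrime P.asIdeal)) =
        (P.asIdeal.map (algebraMap D (Localization.AtPrime P.asIdeal))) ^ n := by
    intro P
    by_cases hP : P ∈ S.starMax
    · have := hdvr P hP
      obtain ⟨n, hn⟩ := exists_map_eq_pow P hA
      exact ⟨n, fun _ => hn⟩
    · exact ⟨0, fun h => absurd h hP⟩
  choose n hn using hn
  -- Only the finitely many `P` containing `a ∈ A` matter: at any other maximal `*`-ideal both `A`
  -- and this product become the unit ideal.
  have hmem : ∏ P ∈ hT.toFinset, P.asIdeal ^ n P ∈
      Submonoid.closure {P : Ideal D | S.IsMaximalStarIdeal P} := by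
    refine Submonoid.prod_mem _ fun P hP => Submonoid.pow_mem _ (Submonoid.subset_closure ?_) _
    exact (hT.mem_toFinset.mp hP).1
  obtain ⟨l, hl, hprod⟩ := Submonoid.exists_list_of_mem_closure hmem
  have hl' : ∀ P ∈ l, S.IsMaximalStarIdeal P := hl
  refine ⟨l, hl', hS.ideal_eq_ideal_of_map_eq hA
    (Ideal.list_prod_ne_bot fun P hP => (hl' P hP).ne_bot) fun Q hQ => ?_⟩
  have hmap := map_prod (Ideal.mapHom (algebraMap D (Localization.AtPrime Q.asIdeal)))
    (fun P : PrimeSpectrum D => P.asIdeal ^ n P) hT.toFinset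
  simp only [Ideal.mapHom_apply] at hmap
  rw [hprod, hmap, Finset.prod_eq_single Q]
  · rw [Ideal.map_pow, hn Q hQ]
  · intro P hP hPQ
    rw [Ideal.map_pow, map_eq_top_of_ne (hT.mem_toFinset.mp hP).1 hQ hPQ, ← Ideal.one_eq_top,
      one_pow]
  · intro hQT
    rw [Ideal.map_pow, ← hn Q hQ, Ideal.one_eq_top]
    refine IsLocalization.AtPrime.map_eq_top_of_not_le (p := Q.asIdeal) _ fun hle => hQT ?_
    exact hT.mem_toFinset.mpr ⟨hQ, hle ha⟩

theorem isStarInvertible_of_mem_list {l : List (Ideal D)}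
    (h : S.IsStarInvertible ((l.prod : Ideal D) : FractionalIdeal D⁰ K)) {P : Ideal D}
    (hP : P ∈ l) : S.IsStarInvertible (P : FractionalIdeal D⁰ K) := by
  obtain ⟨B, hB⟩ := List.dvd_prod hP
  rw [hB, FractionalIdeal.coeIdeal_mul] at h
  exact h.of_mul_left

theorem isStarInvertible_span_singleton {x : D} (hx : x ≠ 0) :
    S.IsStarInvertible ((Ideal.span {x} : Ideal D) : FractionalIdeal D⁰ K) := by
  rw [FractionalIdeal.coeIdeal_span_singleton]
  exact isStarInvertible_spanSingleton (by simpa using hx)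

theorem IsMaximalStarIdeal.mem_of_list_prod_le {l : List (Ideal D)} {P : Ideal D}
    (hl : ∀ Q ∈ l, S.IsMaximalStarIdeal Q) (hP : S.IsMaximalStarIdeal P) (h : l.prod ≤ P) :
    P ∈ l := by
  rw [← Multiset.prod_coe] at h
  obtain ⟨Q, hQ, hQP⟩ := hP.isPrime.multiset_prod_le.mp h
  exact (hl Q hQ).eq_of_le hP hQP ▸ hQ

/-- If every nonzero nonunit generates, up to `*`, a product of maximal `*`-ideals, then the
maximal `*`-ideals are `*`-invertible. -/
theorem IsMaximalStarIdeal.isStarInvertible {P : Ideal D} (hP : S.IsMaximalStarIdeal P)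
    (h : ∀ x : D, x ≠ 0 → ¬ IsUnit x → ∃ l : List (Ideal D),
      (∀ Q ∈ l, S.IsMaximalStarIdeal Q) ∧ S.ideal (Ideal.span {x}) = S.ideal l.prod) :
    S.IsStarInvertible (P : FractionalIdeal D⁰ K) := by
  obtain ⟨x, hx, hx0⟩ := Submodule.exists_mem_ne_zero_of_ne_bot hP.ne_bot
  obtain ⟨l, hl, hxl⟩ := h x hx0 fun hu => hP.isPrime.ne_top (Ideal.eq_top_of_isUnit_mem P hx hu)
  have hle : Ideal.span {x} ≤ P := (Ideal.span_singleton_le_iff_mem P).mpr hx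
  exact isStarInvertible_of_mem_list ((isStarInvertible_span_singleton hx0).of_toFun_eq hxl)
    (hP.mem_of_list_prod_le hl (hP.le_of_ideal_le (hxl ▸ S.ideal_mono hle)))

/-- Up to closure `A` is a product of maximal `*`-ideals, each invertible as a factor of a principal
ideal. -/
theorem IsKrull.isStarInvertible (hS : S.IsFiniteCharacter) (hK : S.IsKrull) {A : Ideal D}
    (hA : A ≠ ⊥) : S.IsStarInvertible (A : FractionalIdeal D⁰ K) := by
  obtain ⟨l, hl, hAl⟩ := hK.exists_ideal_eq_list_prod hS hA
  refine IsStarInvertible.of_toFun_eq (A := ((l.prod : Ideal D) : FractionalIdeal D⁰ K)) ?_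
    hAl.symm
  clear hAl
  induction l with
  | nil => simpa using isStarInvertible_one
  | cons P l ih =>
    rw [List.prod_cons, FractionalIdeal.coeIdeal_mul]
    refine IsStarInvertible.mul ?_ (ih fun Q hQ => hl Q (List.mem_cons_of_mem _ hQ))
    exact (hl P List.mem_cons_self).isStarInvertible fun x hx _ =>
      hK.exists_ideal_eq_list_prod hS (by simpa using hx)

/-- In a `*`-Krull domain each maximal `*`-ideal is `B_*` for a finitely generated ideal `B`. -/
theorem IsKrull.exists_fg_ideal_eq (hS : S.IsFiniteCharacter) (hK : S.IsKrull) {P : Ideal D}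
    (hP : S.IsMaximalStarIdeal P) : ∃ B : Ideal D, B.FG ∧ B ≠ ⊥ ∧ S.ideal B = S.ideal P := by
  obtain ⟨⟨⟨-, hfin, -⟩, -⟩, hdvr⟩ := hK
  have hPp := hP.isPrime
  let P' : PrimeSpectrum D := ⟨P, hPp⟩
  have := hdvr P' hP
  -- `p` is the numerator of a uniformizer of `D_P`.
  obtain ⟨p, hpP, hp0, hp⟩ : ∃ p ∈ P, p ≠ 0 ∧
      P.map (algebraMap D (Localization.AtPrime P)) ≤
        Ideal.span {algebraMap D (Localization.AtPrime P) p} := by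
    obtain ⟨q, hq⟩ := IsDiscreteValuationRing.exists_irreducible (Localization.AtPrime P)
    have hqm := (IsDiscreteValuationRing.irreducible_iff_uniformizer q).mp hq
    have hqP : q ∈ P.map (algebraMap D (Localization.AtPrime P)) := by
      rw [Localization.AtPrime.map_eq_maximalIdeal]
      exact hqm ▸ Ideal.mem_span_singleton_self q
    obtain ⟨⟨⟨p, hpP⟩, s⟩, hps⟩ := (IsLocalization.mem_map_algebraMap_iff P.primeCompl _).mp hqP
    refine ⟨p, hpP, ?_, ?_⟩
    · rintro rfl
      rw [map_zero] at hps
      rcases mul_eq_zero.mp hps with h | h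
      · exact hq.ne_zero h
      · exact (IsLocalization.map_units _ s).ne_zero h
    · rw [Localization.AtPrime.map_eq_maximalIdeal, ← hps,
        Ideal.span_singleton_mul_right_unit (IsLocalization.map_units _ s)]
      exact hqm.le
  have hT := hfin p hp0 fun hu => hPp.ne_top (Ideal.eq_top_of_isUnit_mem P hpP hu)
  have hq : ∀ Q : PrimeSpectrum D, ∃ q ∈ P, Q ∈ S.starMax → Q ≠ P' → q ∉ Q.asIdeal := by
    intro Q
    by_cases hQ : Q ∈ S.starMax ∧ Q ≠ P'
    · by_contra! hcon
      refine hQ.2 (PrimeSpectrum.ext (hP.eq_of_le hQ.1 fun q hq => ?_).symm)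
      exact (hcon q hq).2.2
    · exact ⟨p, hpP, fun h1 h2 => absurd ⟨h1, h2⟩ hQ⟩
  choose q hqP hqQ using hq
  have hBfin : (insert p (q '' {Q | Q ∈ S.starMax ∧ p ∈ Q.asIdeal})).Finite :=
    (hT.image q).insert p
  -- `p` already generates `P D_P` and escapes all but finitely many `Q`; the added elements escape
  -- those among them other than `P`.
  set B : Ideal D := Ideal.span (insert p (q '' {Q | Q ∈ S.starMax ∧ p ∈ Q.asIdeal})) with hB
  have hpB : p ∈ B := Ideal.subset_span (Set.mem_insert _ _)
  have hB0 : B ≠ ⊥ := (Submodule.ne_bot_iff B).mpr ⟨p, hpB, hp0⟩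
  have hBP : B ≤ P := by
    rw [hB, Ideal.span_le]
    rintro y (rfl | ⟨Q, -, rfl⟩)
    · exact hpP
    · exact hqP Q
  refine ⟨B, Submodule.fg_span hBfin, hB0, le_antisymm (S.ideal_mono hBP)
    (hS.ideal_le_ideal_of_map_le hB0 fun Q hQ => ?_)⟩
  rcases eq_or_ne Q P' with rfl | hQP
  · refine hp.trans ?_
    rw [Ideal.span_singleton_le_iff_mem]
    exact Ideal.mem_map_of_mem _ hpB
  · rw [IsLocalization.AtPrime.map_eq_top_of_not_le (I := B) (p := Q.asIdeal) _]
    · exact le_top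
    intro hle
    have hpQ : p ∈ Q.asIdeal := hle hpB
    exact hqQ Q hQ hQP (hle (Ideal.subset_span (Set.mem_insert_of_mem _ ⟨Q, ⟨hQ, hpQ⟩, rfl⟩)))

theorem IsKrull.exists_isAlmostSuperHomogeneousTypeTwo (hS : S.IsFiniteCharacter)
    (hK : S.IsKrull) {P : Ideal D} (hP : S.IsMaximalStarIdeal P) :
    ∃ B : Ideal D, S.IsAlmostSuperHomogeneousTypeTwo B ∧ S.ideal B = S.ideal P := by
  obtain ⟨B, hBfg, hB0, hBP⟩ := hK.exists_fg_ideal_eq hS hP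
  have hhom : S.IsHomogeneousAt P B :=
    ⟨hB0, hBfg, ⟨hP, hP.le_of_ideal_le hBP.le⟩, fun Q hQ hBQ =>
      (hP.eq_of_le hQ (hQ.le_of_ideal_le (hBP ▸ S.ideal_mono hBQ))).symm⟩
  refine ⟨B, ⟨⟨P, hhom, hK.isStarInvertible hS hB0, fun s b _ ⟨r, _, hr⟩ => ?_⟩, P, hhom, 1, le_rfl,
    by rw [pow_one, hBP]⟩, hBP⟩
  -- Exponent 1 suffices, since all nonzero ideals are `*`-invertible. The `b i` are not all zero,
  -- as their closure contains the nonzero ideal `B ^ r`.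
  refine ⟨1, le_rfl, hK.isStarInvertible hS ?_⟩
  simp only [pow_one]
  intro h
  rw [h, ideal, FractionalIdeal.coeIdeal_bot, S.toFun_zero] at hr
  have hz : ((B ^ r : Ideal D) : FractionalIdeal D⁰ K) = 0 := le_bot_iff.mp hr
  rw [FractionalIdeal.coeIdeal_eq_zero] at hz
  exact pow_ne_zero r hB0 hz

theorem IsKrull.isStarProductOf (hS : S.IsFiniteCharacter) (hK : S.IsKrull) {A : Ideal D}
    (hA : A ≠ ⊥) (hA1 : S.ideal A ≠ 1) :
    S.IsStarProductOf S.IsAlmostSuperHomogeneousTypeTwo (S.ideal A) := by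
  obtain ⟨l, hl, hAl⟩ := hK.exists_ideal_eq_list_prod hS hA
  have key : ∃ m : List (Ideal D), m.length = l.length ∧
      (∀ B ∈ m, S.IsAlmostSuperHomogeneousTypeTwo B) ∧ S.ideal l.prod = S.ideal m.prod := by
    clear hAl
    induction l with
    | nil => exact ⟨[], rfl, by simp, rfl⟩
    | cons P l ih =>
      obtain ⟨m, hml, hm, hlm⟩ := ih fun Q hQ => hl Q (List.mem_cons_of_mem _ hQ)
      obtain ⟨B, hB, hBP⟩ :=
        hK.exists_isAlmostSuperHomogeneousTypeTwo hS (hl P List.mem_cons_self)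
      refine ⟨B :: m, by simp [hml], ?_, ?_⟩
      · intro C hC
        rcases List.mem_cons.mp hC with rfl | hC
        · exact hB
        · exact hm C hC
      · rw [List.prod_cons, List.prod_cons]
        exact S.ideal_mul_congr hBP.symm hlm
  obtain ⟨m, hml, hm, hlm⟩ := key
  refine ⟨m, ?_, hm, hAl.trans hlm⟩
  -- An empty product would force `A_* = D`.
  rintro rfl
  rw [hAl, hlm, List.prod_nil, Ideal.one_eq_top, S.ideal_top] at hA1
  exact hA1 rfl

/-! ### From `*`-SH of type 2 to `*`-Krull. -/

theorem IsSHTypeTwo.exists_ideal_eq_list_prod (hD : S.IsSHTypeTwo) (x : D) (hx : x ≠ 0)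
    (hxu : ¬ IsUnit x) :
    ∃ l : List (Ideal D), (∀ P ∈ l, S.IsMaximalStarIdeal P) ∧
      S.ideal (Ideal.span {x}) = S.ideal l.prod := by
  obtain ⟨m, -, hm, hxm⟩ := hD x hx hxu
  rw [S.ideal_span_singleton, hxm]
  clear hxm
  induction m with
  | nil => exact ⟨[], by simp, rfl⟩
  | cons A m ih =>
    obtain ⟨l, hl, hml⟩ := ih fun B hB => hm B (List.mem_cons_of_mem _ hB)
    obtain ⟨P, hPA, n, -, hn⟩ := hm A List.mem_cons_self
    refine ⟨List.replicate n P ++ l, ?_, ?_⟩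
    · intro Q hQ
      rcases List.mem_append.mp hQ with hQ | hQ
      · rw [List.eq_of_mem_replicate hQ]
        exact hPA.2.2.1.1
      · exact hl Q hQ
    · rw [List.prod_cons, List.prod_append, List.prod_replicate]
      exact S.ideal_mul_congr hn hml

/-- A `*`-invertible maximal `*`-ideal is locally principal. -/
theorem IsMaximalStarIdeal.exists_map_eq_span {P : Ideal D} [P.IsPrime]
    (hP : S.IsMaximalStarIdeal P) (hinv : S.IsStarInvertible (P : FractionalIdeal D⁰ K)) :
    ∃ p : D, P.map (algebraMap D (Localization.AtPrime P)) =
      Ideal.span {algebraMap D (Localization.AtPrime P) p} := by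
  have hmul : ∀ u ∈ (P : FractionalIdeal D⁰ K)⁻¹, ∀ q ∈ P, ∃ d : D,
      algebraMap D K d = u * algebraMap D K q := by
    intro u hu q hq
    exact (FractionalIdeal.mem_one_iff D⁰).mp ((FractionalIdeal.mem_inv_iff hinv.1).mp hu _
      (FractionalIdeal.mem_coeIdeal_of_mem _ hq))
  -- If `P P⁻¹ ⊆ P`, closing up would give `D ⊆ P`. So some `s = u p` is a unit of `D_P`, and `s q =
  -- (u q) p` shows that `p` divides each `q ∈ P` there.
  obtain ⟨p, hp, u, hu, s, hs, hsP⟩ : ∃ p ∈ P, ∃ u ∈ (P : FractionalIdeal D⁰ K)⁻¹, ∃ s : D,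
      algebraMap D K s = u * algebraMap D K p ∧ s ∉ P := by
    by_contra! hcon
    have hle : (P : FractionalIdeal D⁰ K) * (P : FractionalIdeal D⁰ K)⁻¹ ≤ P := by
      rw [FractionalIdeal.mul_le]
      intro y hy u hu
      obtain ⟨p, hp, rfl⟩ := (FractionalIdeal.mem_coeIdeal _).mp hy
      obtain ⟨d, hd⟩ := hmul u hu p hp
      rw [mul_comm, ← hd]
      exact FractionalIdeal.mem_coeIdeal_of_mem _ (hcon p hp u hu d hd)
    have h1 := S.toFun_mono hle
    rw [hinv.2] at h1
    change _ ≤ S.ideal P at h1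
    rw [hP.ideal_eq, ← FractionalIdeal.coeIdeal_top (R := D),
      FractionalIdeal.coeIdeal_le_coeIdeal] at h1
    exact hP.isPrime.ne_top (top_le_iff.mp h1)
  refine ⟨p, le_antisymm ?_ ?_⟩
  · rw [Ideal.map_le_iff_le_comap]
    intro q hq
    obtain ⟨d, hd⟩ := hmul u hu q hq
    have hsq : s * q = d * p := by
      apply IsFractionRing.injective D K
      rw [map_mul, map_mul, hs, hd]
      ring
    rw [Ideal.mem_comap, Ideal.mem_span_singleton,
      ← (IsLocalization.map_units (Localization.AtPrime P)
        (⟨s, hsP⟩ : P.primeCompl)).dvd_mul_left, ← map_mul, hsq, map_mul]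
    exact dvd_mul_left _ _
  · rw [Ideal.span_singleton_le_iff_mem]
    exact Ideal.mem_map_of_mem _ hp

theorem _root_.Ideal.exists_map_list_prod_eq_pow {R : Type*} [CommRing R] (P : Ideal R)
    [P.IsPrime] {l : List (Ideal R)} (h : ∀ Q ∈ l, Q = P ∨ ¬ Q ≤ P) :
    ∃ n : ℕ, l.prod.map (algebraMap R (Localization.AtPrime P)) =
      (P.map (algebraMap R (Localization.AtPrime P))) ^ n := by
  induction l with
  | nil => exact ⟨0, by rw [List.prod_nil, Ideal.one_eq_top, Ideal.map_top, pow_zero,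
      Ideal.one_eq_top]⟩
  | cons Q l ih =>
    obtain ⟨n, hn⟩ := ih fun I hI => h I (List.mem_cons_of_mem _ hI)
    rw [List.prod_cons, Ideal.map_mul, hn]
    rcases h Q List.mem_cons_self with rfl | hQ
    · exact ⟨n + 1, (pow_succ' _ _).symm⟩
    · rw [IsLocalization.AtPrime.map_eq_top_of_not_le (I := Q) (p := P) _ hQ, Ideal.top_mul]
      exact ⟨n, rfl⟩

/-- With `π` a prime generating the maximal ideal, it is enough that each nonzero element divides a
power of `π`. For a nonunit numerator `x`, localize the inclusion `l.prod ⊆ (l.prod)_* = xD`; the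
left side becomes `(π ^ n)`. The closure itself is never localized. -/
theorem IsSHTypeTwo.isDiscreteValuationRing (hD : S.IsSHTypeTwo) {P : Ideal D} [P.IsPrime]
    (hP : S.IsMaximalStarIdeal P) : IsDiscreteValuationRing (Localization.AtPrime P) := by
  obtain ⟨p, hp⟩ :=
    hP.exists_map_eq_span (hP.isStarInvertible hD.exists_ideal_eq_list_prod)
  set R := Localization.AtPrime P
  set π := algebraMap D R p
  have hinj : Function.Injective (algebraMap D R) :=
    IsLocalization.injective _ P.primeCompl_le_nonZeroDivisors
  have hmax : Ideal.span {π} = IsLocalRing.maximalIdeal R := by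
    rw [← hp]
    exact Localization.AtPrime.map_eq_maximalIdeal
  have hπ0 : π ≠ 0 := by
    intro h0
    rw [h0, Ideal.span_singleton_zero, Ideal.map_eq_bot_iff_of_injective hinj] at hp
    exact hP.ne_bot hp
  have hπ : Prime π := by
    rw [← Ideal.span_singleton_prime hπ0, hmax]
    infer_instance
  refine IsDiscreteValuationRing.ofHasUnitMulPowIrreducibleFactorization
    ⟨π, hπ.irreducible, fun {y} hy => ?_⟩
  suffices h : ∃ n : ℕ, y ∣ π ^ n by
    obtain ⟨n, hn⟩ := h
    obtain ⟨m, -, hm⟩ := (dvd_prime_pow hπ n).mp hn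
    exact ⟨m, hm.symm⟩
  obtain ⟨⟨x, s⟩, hxs⟩ := IsLocalization.surj P.primeCompl y
  have hs : IsUnit (algebraMap D R s) := IsLocalization.map_units R s
  suffices h : ∃ n : ℕ, algebraMap D R x ∣ π ^ n by
    obtain ⟨n, hn⟩ := h
    exact ⟨n, hs.mul_right_dvd.mp (hxs ▸ hn)⟩
  have hx0 : x ≠ 0 := by
    rintro rfl
    rw [map_zero] at hxs
    exact mul_ne_zero hy hs.ne_zero hxs
  by_cases hxu : IsUnit x
  · exact ⟨0, (hxu.map _).dvd⟩
  obtain ⟨l, hl, hxl⟩ := hD.exists_ideal_eq_list_prod x hx0 hxu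
  obtain ⟨n, hn⟩ := Ideal.exists_map_list_prod_eq_pow P (l := l) fun Q hQ =>
    or_iff_not_imp_right.mpr fun h => (hl Q hQ).eq_of_le hP (not_not.mp h)
  refine ⟨n, ?_⟩
  rw [hp, Ideal.span_singleton_pow] at hn
  have hle : l.prod ≤ Ideal.span {x} := by
    rw [← FractionalIdeal.coeIdeal_le_coeIdeal K, ← S.ideal_span_singleton, hxl]
    exact S.coe_le_ideal _
  have h2 := Ideal.map_mono (f := algebraMap D R) hle
  rw [Ideal.map_span, Set.image_singleton, hn] at h2
  exact Ideal.span_singleton_le_span_singleton.mp h2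

theorem _root_.Ideal.height_eq_one_of_isDiscreteValuationRing (P : Ideal D) [P.IsPrime]
    [IsDiscreteValuationRing (Localization.AtPrime P)] : P.height = 1 := by
  have h := IsLocalization.AtPrime.ringKrullDim_eq_height P (Localization.AtPrime P)
  rw [IsPrincipalIdealRing.ringKrullDim_eq_one _ (IsDiscreteValuationRing.not_isField _)] at h
  exact_mod_cast h.symm

theorem _root_.Ideal.eq_of_le_of_height_eq_one {N P : Ideal D} [N.IsPrime] [P.IsPrime]
    (hN : N ≠ ⊥) (hNP : N ≤ P) (hP : P.height = 1) : N = P := by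
  refine eq_of_le_of_not_lt hNP fun hlt => ?_
  have hfin : P.FiniteHeight := P.finiteHeight_iff.mpr (Or.inr (by rw [hP]; exact ENat.one_ne_top))
  have h := Ideal.height_strict_mono_of_isPrime_of_isPrime hlt
  rw [hP, Order.lt_one_iff, Ideal.height_eq_zero_iff, IsDomain.minimalPrimes_eq_singleton_bot] at h
  exact hN h

/-- The maximal `*`-ideals containing `x` all occur in its factorization, whence local finiteness.
DVR localizations force height one, whence independence. A height-one prime containing `x` contains
one of the factors of `x`, hence equals it. -/
theorem IsSHTypeTwo.isKrull (hS : S.IsFiniteCharacter) (hD : S.IsSHTypeTwo) : S.IsKrull := by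
  have hdvr : ∀ P ∈ S.starMax, IsDiscreteValuationRing (Localization.AtPrime P.asIdeal) :=
    fun P hP => hD.isDiscreteValuationRing hP
  have hheight : ∀ P ∈ S.starMax, P.asIdeal.height = 1 := fun P hP =>
    have := hdvr P hP
    Ideal.height_eq_one_of_isDiscreteValuationRing P.asIdeal
  refine ⟨⟨⟨hS.isDefiningFamily_starMax, ?_, ?_⟩, ?_⟩, hdvr⟩
  · intro x hx hxu
    obtain ⟨l, hl, hxl⟩ := hD.exists_ideal_eq_list_prod x hx hxu
    refine Set.Finite.of_finite_image (f := PrimeSpectrum.asIdeal)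
      ((List.finite_toSet l).subset ?_) fun P _ Q _ h => PrimeSpectrum.ext h
    rintro _ ⟨P, ⟨hP, hxP⟩, rfl⟩
    refine IsMaximalStarIdeal.mem_of_list_prod_le hl hP (hP.le_of_ideal_le ?_)
    rw [← hxl]
    exact S.ideal_mono ((Ideal.span_singleton_le_iff_mem _).mpr hxP)
  · rintro P hP Q hQ hPQ ⟨N, hN, hN0, hNP, hNQ⟩
    refine hPQ (PrimeSpectrum.ext ?_)
    rw [← Ideal.eq_of_le_of_height_eq_one hN0 hNP (hheight P hP),
      Ideal.eq_of_le_of_height_eq_one hN0 hNQ (hheight Q hQ)]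
  · refine Set.Subset.antisymm hheight fun N hN => ?_
    have hN0 : N.asIdeal ≠ ⊥ := by
      intro h
      have h1 : N.asIdeal.height = 1 := hN
      rw [h, Ideal.height_bot] at h1
      exact zero_ne_one h1
    obtain ⟨x, hx, hx0⟩ := Submodule.exists_mem_ne_zero_of_ne_bot hN0
    obtain ⟨l, hl, hxl⟩ := hD.exists_ideal_eq_list_prod x hx0
      fun hu => N.isPrime.ne_top (Ideal.eq_top_of_isUnit_mem _ hx hu)
    have hle : l.prod ≤ N.asIdeal := by
      refine le_trans ?_ ((Ideal.span_singleton_le_iff_mem _).mpr hx)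
      rw [← FractionalIdeal.coeIdeal_le_coeIdeal K, ← S.ideal_span_singleton, hxl]
      exact S.coe_le_ideal _
    rw [← Multiset.prod_coe] at hle
    obtain ⟨P, hP, hPN⟩ := N.isPrime.multiset_prod_le.mp hle
    have hPmax : S.IsMaximalStarIdeal P := hl P hP
    have := hPmax.isPrime
    have hPN' := Ideal.eq_of_le_of_height_eq_one hPmax.ne_bot hPN hN
    change S.IsMaximalStarIdeal N.asIdeal
    exact hPN' ▸ hPmax

end StarOperation

/-! ### The cycle of implications. -/

theorem corollary3p3 {D K : Type*} [CommRing D] [IsDomain D] [Field K] [Algebra D K]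
    [IsFractionRing D K] (S : StarOperation D K) (hS : S.IsFiniteCharacter) :
    List.TFAE
      [S.IsAlmostSuperSHTypeTwo,
       S.IsKrull,
       ∀ A : Ideal D, A.FG → S.IsStarInvertible (A : FractionalIdeal D⁰ K) → S.ideal A ≠ 1 →
         S.IsStarProductOf S.IsAlmostSuperHomogeneousTypeTwo (S.ideal A),
       S.IsSHTypeTwo] := by
  tfae_have 1 → 4 := by
    intro h x hx hxu
    obtain ⟨l, hl0, hl, hxl⟩ := h x hx hxu
    exact ⟨l, hl0, fun A hA => (hl A hA).2, hxl⟩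
  tfae_have 4 → 2 := fun h => h.isKrull hS
  tfae_have 2 → 3 := by
    intro h A _ hA hA1
    exact h.isStarProductOf hS (FractionalIdeal.coeIdeal_ne_zero.mp hA.1) hA1
  tfae_have 3 → 1 := by
    intro h x hx hxu
    rw [← S.ideal_span_singleton]
    refine h _ (Submodule.fg_span_singleton x)
      (StarOperation.isStarInvertible_span_singleton hx) ?_
    rw [S.ideal_span_singleton, Ne, ← FractionalIdeal.coeIdeal_top (R := D),
      FractionalIdeal.coeIdeal_inj, Ideal.span_singleton_eq_top]
    exact hxu
  tfae_finish
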